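/- Conventions. An $\ell$-group is a lattice-ordered group, not necessarily Abelian, written additively; an $\ell$-homomorphism is a group homomorphism that is also a lattice homomorphism. For an $\ell$-group $G$, $\mathrm{Cs}_{\mathrm c}\,G$ denotes the lattice of all finitely generated convex $\ell$-subgroups of $G$, and $\mathrm{Id}_{\mathrm c}\,G$ the join-semilattice with zero of all finitely generated $\ell$-ideals (normal convex $\ell$-subgroups) of $G$, both ordered by inclusion. They are functors: an $\ell$-homomorphism $f\colon G\to H$ acts by sending $S$ to the convex $\ell$-subgroup (respectively, $\ell$-ideal) of $H$ generated by $f[S]$. An $\ell$-group is representable if it is a subdirect product of totally ordered groups. Let $\mathfrak{P}[3]=\{\varnothing,1,2,3,12,13,23,123\}$ be the powerset of $\{1,2,3\}$, ordered by inclusion. For a poset $P$, a $P$-indexed diagram $D$ in a category assigns to each $p\in P$ an object $D(p)$ and to each pair $p\le q$ a nonempty set $D(p,q)$ of morphisms $D(p)\to D(q)$, such that $\mathrm{id}_{D(p)}\in D(p,p)$ and $v\circ u\in D(p,r)$ whenever $u\in D(p,q)$ and $v\in D(q,r)$; it is commutative if every $D(p,q)$ is a singleton. Functors are applied to diagrams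 arrow by arrow. Let $A_{123}$ be the Abelian $\ell$-group defined by the generators $a,a',b,c$ and the relations $0\le a\le a'\le 2a$, $0\le b$, $0\le c$. Let $A_{12},A_{13},A_{23},A_1,A_2,A_3$ be the $\ell$-subgroups of $A_{123}$ generated by $\{a,b\}$, $\{a',c\}$, $\{b,c\}$, $\{a\}$, $\{b\}$, $\{c\}$, respectively, and let $A_\varnothing=\{0\}$. Let $\vec A$ be the $\mathfrak{P}[3]$-indexed diagram with vertices $A_p$ in which, for $p\le q$, the only arrow $A_p\to A_q$ is the inclusion map, with two exceptions: the only arrow $A_1\to A_{13}$ is the $\ell$-homomorphism sending $a$ to $a'$, and there are exactly two arrows $A_1\to A_{123}$, namely the inclusion map and the $\ell$-homomorphism sending $a$ to $a'$. (The diagram $\vec A$ is not commutative, but $\mathrm{Id}_{\mathrm c}\,\vec A$ is.) Corollary 5.14. There is no $\mathfrak{P}[3]$-indexed commutative diagram $\vec G$ of $\ell$-groups and $\ell$-homomorphisms such that $\mathrm{Cs}_{\mathrm c}\,\vec G\cong\mathrm{Id}_{\mathrm c}\,\vec A$. Likewise, there is no $\mathfrak{P}[3]$-indexed commutative diagram $\vec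 G$ of representable $\ell$-groups and $\ell$-homomorphisms such that $\mathrm{Id}_{\mathrm c}\,\vec G\cong\mathrm{Id}_{\mathrm c}\,\vec A$. -/

import Mathlib

/-!
Lattice-ordered groups (ℓ-groups) are additive, not necessarily commutative groups `G` with
`[AddGroup G] [Lattice G] [AddLeftMono G] [AddRightMono G]`.
-/

universe u v w

namespace LatGrp

/-! ### ℓ-homomorphisms -/

/-- An ℓ-homomorphism: a group homomorphism that is also a lattice homomorphism. -/
structure LHom (G : Type u) (H : Type v) [AddGroup G] [Lattice G] [AddGroup H] [Lattice H]
    extends G →+ H where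
  map_sup' : ∀ x y, toFun (x ⊔ y) = toFun x ⊔ toFun y
  map_inf' : ∀ x y, toFun (x ⊓ y) = toFun x ⊓ toFun y

namespace LHom

variable {G : Type u} {H : Type v} {K : Type w} [AddGroup G] [Lattice G] [AddGroup H] [Lattice H]
  [AddGroup K] [Lattice K]

instance : FunLike (LHom G H) G H where
  coe f := f.toFun
  coe_injective := by
    rintro ⟨f, _, _⟩ ⟨g, _, _⟩ h
    congr
    exact DFunLike.coe_injective h

instance : AddMonoidHomClass (LHom G H) G H where
  map_add f := f.map_add'
  map_zero f := f.map_zero'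

instance : LatticeHomClass (LHom G H) G H where
  map_sup f := f.map_sup'
  map_inf f := f.map_inf'

/-- The identity ℓ-homomorphism. -/
def id (G : Type u) [AddGroup G] [Lattice G] : LHom G G where
  toAddMonoidHom := AddMonoidHom.id G
  map_sup' _ _ := rfl
  map_inf' _ _ := rfl

/-- The composite `g ∘ f`. -/
def comp (g : LHom H K) (f : LHom G H) : LHom G K where
  toAddMonoidHom := g.toAddMonoidHom.comp f.toAddMonoidHom
  map_sup' x y := by
    change g (f (x ⊔ y)) = g (f x) ⊔ g (f y)
    simp
  map_inf' x y := by
    change g (f (x ⊓ y)) = g (f x) ⊓ g (f y)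
    simp

@[simp] theorem id_apply (x : G) : LHom.id G x = x := rfl

@[simp] theorem comp_apply (g : LHom H K) (f : LHom G H) (x : G) : g.comp f x = g (f x) := rfl

end LHom

/-- An ℓ-group is representable if it is a subdirect product of totally ordered groups: it has a
family of surjective ℓ-homomorphisms onto totally ordered groups that jointly separate points. -/
def IsRepresentable (G : Type u) [AddGroup G] [Lattice G] : Prop :=
  ∃ (I : Type u) (T : I → Type u) (_ : ∀ i, AddGroup (T i)) (_ : ∀ i, LinearOrder (T i))
    (_ : ∀ i, AddLeftMono (T i)) (_ : ∀ i, AddRightMono (T i)) (π : ∀ i, LHom G (T i)),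
    (∀ i, Function.Surjective (π i)) ∧ ∀ x y : G, (∀ i, π i x = π i y) → x = y

/-! ### Convex ℓ-subgroups and ℓ-ideals -/

section Subobjects

variable {G : Type u} {H : Type v} [AddGroup G] [Lattice G] [AddGroup H] [Lattice H]

/-- `S` is (the underlying set of) an ℓ-subgroup of `G`. -/
structure IsLSubgroup (S : Set G) : Prop where
  zero_mem : 0 ∈ S
  add_mem : ∀ x ∈ S, ∀ y ∈ S, x + y ∈ S
  neg_mem : ∀ x ∈ S, -x ∈ S
  sup_mem : ∀ x ∈ S, ∀ y ∈ S, x ⊔ y ∈ S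
  inf_mem : ∀ x ∈ S, ∀ y ∈ S, x ⊓ y ∈ S

/-- `S` is a convex ℓ-subgroup of `G`. -/
structure IsConvexLSubgroup (S : Set G) : Prop extends IsLSubgroup S where
  convex : ∀ x ∈ S, ∀ z ∈ S, ∀ y, x ≤ y → y ≤ z → y ∈ S

/-- `S` is an ℓ-ideal of `G`, i.e. a normal convex ℓ-subgroup. -/
structure IsLIdeal (S : Set G) : Prop extends IsConvexLSubgroup S where
  normal : ∀ g, ∀ x ∈ S, g + x - g ∈ S

theorem IsLSubgroup.sInf (F : Set (Set G)) (h : ∀ S ∈ F, IsLSubgroup S) :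
    IsLSubgroup (sInf F) where
  zero_mem S hS := (h S hS).zero_mem
  add_mem x hx y hy S hS := (h S hS).add_mem x (hx S hS) y (hy S hS)
  neg_mem x hx S hS := (h S hS).neg_mem x (hx S hS)
  sup_mem x hx y hy S hS := (h S hS).sup_mem x (hx S hS) y (hy S hS)
  inf_mem x hx y hy S hS := (h S hS).inf_mem x (hx S hS) y (hy S hS)

theorem IsConvexLSubgroup.sInf (F : Set (Set G)) (h : ∀ S ∈ F, IsConvexLSubgroup S) :
    IsConvexLSubgroup (sInf F) where
  toIsLSubgroup := IsLSubgroup.sInf F fun S hS => (h S hS).toIsLSubgroup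
  convex x hx z hz y hxy hyz S hS := (h S hS).convex x (hx S hS) z (hz S hS) y hxy hyz

theorem IsLIdeal.sInf (F : Set (Set G)) (h : ∀ S ∈ F, IsLIdeal S) : IsLIdeal (sInf F) where
  toIsConvexLSubgroup := IsConvexLSubgroup.sInf F fun S hS => (h S hS).toIsConvexLSubgroup
  normal g x hx S hS := (h S hS).normal g x (hx S hS)

variable (G) in
/-- The ℓ-subgroup generated by a set. -/
def lClosure : ClosureOperator (Set G) := .ofCompletePred IsLSubgroup IsLSubgroup.sInf

variable (G) in
/-- The convex ℓ-subgroup generated by a set. -/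
def convexLClosure : ClosureOperator (Set G) :=
  .ofCompletePred IsConvexLSubgroup IsConvexLSubgroup.sInf

variable (G) in
/-- The ℓ-ideal generated by a set. -/
def lIdealClosure : ClosureOperator (Set G) := .ofCompletePred IsLIdeal IsLIdeal.sInf

theorem IsLSubgroup.preimage (f : LHom G H) {S : Set H} (h : IsLSubgroup S) :
    IsLSubgroup (f ⁻¹' S) where
  zero_mem := by simpa using h.zero_mem
  add_mem x hx y hy := by simpa using h.add_mem _ hx _ hy
  neg_mem x hx := by simpa using h.neg_mem _ hx
  sup_mem x hx y hy := by simpa using h.sup_mem _ hx _ hy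
  inf_mem x hx y hy := by simpa using h.inf_mem _ hx _ hy

theorem IsConvexLSubgroup.preimage (f : LHom G H) {S : Set H} (h : IsConvexLSubgroup S) :
    IsConvexLSubgroup (f ⁻¹' S) where
  toIsLSubgroup := h.toIsLSubgroup.preimage f
  convex _ hx _ hz _ hxy hyz := h.convex _ hx _ hz _ (OrderHomClass.mono f hxy)
    (OrderHomClass.mono f hyz)

theorem IsLIdeal.preimage (f : LHom G H) {S : Set H} (h : IsLIdeal S) :
    IsLIdeal (f ⁻¹' S) where
  toIsConvexLSubgroup := h.toIsConvexLSubgroup.preimage f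
  normal g x hx := by simpa using h.normal (f g) _ hx

end Subobjects

/-! ### Finitely generated closed sets -/

/-- The finitely generated closed sets of a closure operator, ordered by inclusion. -/
def FGClosed {α : Type u} (cl : ClosureOperator (Set α)) : Type u :=
  {S : Set α // ∃ s : Set α, s.Finite ∧ cl s = S}

namespace FGClosed

variable {α : Type u} {β : Type v} {γ : Type w} {cl : ClosureOperator (Set α)}
  {cl' : ClosureOperator (Set β)} {cl'' : ClosureOperator (Set γ)}

instance : PartialOrder (FGClosed cl) := inferInstanceAs (PartialOrder (Subtype _))

theorem isClosed (S : FGClosed cl) : cl.IsClosed S.1 := by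
  obtain ⟨_, s, _, rfl⟩ := S
  exact cl.isClosed_closure s

/-- The join of two finitely generated closed sets is the closed set that they generate. -/
instance : SemilatticeSup (FGClosed cl) where
  sup S T := ⟨cl (S.1 ∪ T.1), by
    obtain ⟨_, s, hs, rfl⟩ := S
    obtain ⟨_, t, ht, rfl⟩ := T
    exact ⟨s ∪ t, hs.union ht, (cl.closure_sup_closure s t).symm⟩⟩
  le_sup_left S T := Set.subset_union_left.trans (cl.le_closure _)
  le_sup_right S T := Set.subset_union_right.trans (cl.le_closure _)
  sup_le S T U hS hT := ClosureOperator.closure_min (Set.union_subset hS hT) U.isClosed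

instance : OrderBot (FGClosed cl) where
  bot := ⟨cl ∅, ∅, Set.finite_empty, rfl⟩
  bot_le S := ClosureOperator.closure_min (Set.empty_subset _) S.isClosed

theorem closure_image_closure (f : α → β)
    (hf : ∀ T, cl'.IsClosed T → cl.IsClosed (f ⁻¹' T)) (s : Set α) :
    cl' (f '' cl s) = cl' (f '' s) := by
  apply le_antisymm
  · refine ClosureOperator.closure_min ?_ (cl'.isClosed_closure _)
    refine Set.image_subset_iff.2 (ClosureOperator.closure_min ?_ (hf _ (cl'.isClosed_closure _)))
    exact Set.image_subset_iff.1 (cl'.le_closure _)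
  · exact cl'.monotone (Set.image_mono (cl.le_closure s))

/-- The map sending a finitely generated closed set `S` to the closed set generated by `f '' S`. -/
def map (f : α → β) (hf : ∀ T, cl'.IsClosed T → cl.IsClosed (f ⁻¹' T)) :
    SupBotHom (FGClosed cl) (FGClosed cl') where
  toFun S := ⟨cl' (f '' S.1), by
    obtain ⟨_, s, hs, rfl⟩ := S
    exact ⟨f '' s, hs.image f, (closure_image_closure f hf s).symm⟩⟩
  map_sup' S T := Subtype.ext <| by
    change cl' (f '' cl (S.1 ∪ T.1)) = cl' (cl' (f '' S.1) ∪ cl' (f '' T.1))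
    rw [closure_image_closure f hf, Set.image_union]
    exact (cl'.closure_sup_closure _ _).symm
  map_bot' := Subtype.ext <| by
    change cl' (f '' cl ∅) = cl' ∅
    rw [closure_image_closure f hf, Set.image_empty]

@[simp] theorem map_val (f : α → β) (hf : ∀ T, cl'.IsClosed T → cl.IsClosed (f ⁻¹' T))
    (S : FGClosed cl) : (map f hf S).1 = cl' (f '' S.1) := rfl

end FGClosed

section Functors

variable {G : Type u} {H : Type v} {K : Type w} [AddGroup G] [Lattice G] [AddGroup H] [Lattice H]
  [AddGroup K] [Lattice K]

/-- `Csc G`: the finitely generated convex ℓ-subgroups of `G`, ordered by inclusion. -/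
abbrev Csc (G : Type u) [AddGroup G] [Lattice G] : Type u := FGClosed (convexLClosure G)

/-- `Idc G`: the finitely generated ℓ-ideals of `G`, ordered by inclusion. -/
abbrev Idc (G : Type u) [AddGroup G] [Lattice G] : Type u := FGClosed (lIdealClosure G)

/-- `Csc f` sends `S` to the convex ℓ-subgroup generated by `f '' S`. -/
def Csc.map (f : LHom G H) : SupBotHom (Csc G) (Csc H) :=
  FGClosed.map f fun _ h => IsConvexLSubgroup.preimage f h

/-- `Idc f` sends `S` to the ℓ-ideal generated by `f '' S`. -/
def Idc.map (f : LHom G H) : SupBotHom (Idc G) (Idc H) :=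
  FGClosed.map f fun _ h => IsLIdeal.preimage f h

theorem Csc.map_id : Csc.map (LHom.id G) = SupBotHom.id (Csc G) := by
  ext S : 1
  refine Subtype.ext ?_
  change convexLClosure G ((fun x => x) '' S.1) = S.1
  rw [Set.image_id']
  exact S.isClosed.closure_eq

theorem Idc.map_id : Idc.map (LHom.id G) = SupBotHom.id (Idc G) := by
  ext S : 1
  refine Subtype.ext ?_
  change lIdealClosure G ((fun x => x) '' S.1) = S.1
  rw [Set.image_id']
  exact S.isClosed.closure_eq

theorem Csc.map_comp (g : LHom H K) (f : LHom G H) :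
    Csc.map (g.comp f) = (Csc.map g).comp (Csc.map f) := by
  ext S : 1
  refine Subtype.ext ?_
  change convexLClosure K ((g ∘ f) '' S.1) = convexLClosure K (g '' convexLClosure H (f '' S.1))
  rw [FGClosed.closure_image_closure g fun _ h => IsConvexLSubgroup.preimage g h, Set.image_comp]

theorem Idc.map_comp (g : LHom H K) (f : LHom G H) :
    Idc.map (g.comp f) = (Idc.map g).comp (Idc.map f) := by
  ext S : 1
  refine Subtype.ext ?_
  change lIdealClosure K ((g ∘ f) '' S.1) = lIdealClosure K (g '' lIdealClosure H (f '' S.1))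
  rw [FGClosed.closure_image_closure g fun _ h => IsLIdeal.preimage g h, Set.image_comp]

end Functors

/-! ### Poset-indexed diagrams, not necessarily commutative -/

/-- A `P`-indexed diagram of ℓ-groups and ℓ-homomorphisms. To each pair `p ≤ q` it assigns a
nonempty set of ℓ-homomorphisms; these sets contain the identities and are closed under
composition. -/
structure LGroupDiagram (P : Type w) [PartialOrder P] where
  obj : P → Type u
  [addGroup : ∀ p, AddGroup (obj p)]
  [lattice : ∀ p, Lattice (obj p)]
  [addLeftMono : ∀ p, AddLeftMono (obj p)]
  [addRightMono : ∀ p, AddRightMono (obj p)]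
  arrows : ∀ {p q : P}, p ≤ q → Set (LHom (obj p) (obj q))
  arrows_nonempty : ∀ {p q : P} (h : p ≤ q), (arrows h).Nonempty
  id_mem : ∀ p, LHom.id (obj p) ∈ arrows (le_refl p)
  comp_mem : ∀ {p q r : P} (hpq : p ≤ q) (hqr : q ≤ r), ∀ f ∈ arrows hpq, ∀ g ∈ arrows hqr,
    g.comp f ∈ arrows (hpq.trans hqr)

attribute [instance] LGroupDiagram.addGroup LGroupDiagram.lattice LGroupDiagram.addLeftMono
  LGroupDiagram.addRightMono

/-- A `P`-indexed diagram of join-semilattices with zero, in the same sense. -/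
structure SemilatDiagram (P : Type w) [PartialOrder P] where
  obj : P → Type u
  [semilatticeSup : ∀ p, SemilatticeSup (obj p)]
  [orderBot : ∀ p, OrderBot (obj p)]
  arrows : ∀ {p q : P}, p ≤ q → Set (SupBotHom (obj p) (obj q))
  arrows_nonempty : ∀ {p q : P} (h : p ≤ q), (arrows h).Nonempty
  id_mem : ∀ p, SupBotHom.id (obj p) ∈ arrows (le_refl p)
  comp_mem : ∀ {p q r : P} (hpq : p ≤ q) (hqr : q ≤ r), ∀ f ∈ arrows hpq, ∀ g ∈ arrows hqr,
    g.comp f ∈ arrows (hpq.trans hqr)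

attribute [instance] SemilatDiagram.semilatticeSup SemilatDiagram.orderBot

section Diagrams

variable {P : Type w} [PartialOrder P]

/-- A diagram is commutative if there is exactly one arrow for each pair `p ≤ q`. -/
def LGroupDiagram.IsCommutative (D : LGroupDiagram.{u} P) : Prop :=
  ∀ (p q : P) (h : p ≤ q), ∃ f, D.arrows h = {f}

/-- A diagram is commutative if there is exactly one arrow for each pair `p ≤ q`. -/
def SemilatDiagram.IsCommutative (D : SemilatDiagram.{u} P) : Prop :=
  ∀ (p q : P) (h : p ≤ q), ∃ f, D.arrows h = {f}

/-- The image of a diagram of ℓ-groups under the functor `Csc`. -/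
abbrev LGroupDiagram.csc (D : LGroupDiagram.{u} P) : SemilatDiagram.{u} P where
  obj p := Csc (D.obj p)
  arrows h := Csc.map '' D.arrows h
  arrows_nonempty h := (D.arrows_nonempty h).image _
  id_mem p := ⟨_, D.id_mem p, Csc.map_id⟩
  comp_mem := by
    rintro p q r hpq hqr _ ⟨f, hf, rfl⟩ _ ⟨g, hg, rfl⟩
    exact ⟨_, D.comp_mem hpq hqr f hf g hg, Csc.map_comp g f⟩

/-- The image of a diagram of ℓ-groups under the functor `Idc`. -/
abbrev LGroupDiagram.idc (D : LGroupDiagram.{u} P) : SemilatDiagram.{u} P where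
  obj p := Idc (D.obj p)
  arrows h := Idc.map '' D.arrows h
  arrows_nonempty h := (D.arrows_nonempty h).image _
  id_mem p := ⟨_, D.id_mem p, Idc.map_id⟩
  comp_mem := by
    rintro p q r hpq hqr _ ⟨f, hf, rfl⟩ _ ⟨g, hg, rfl⟩
    exact ⟨_, D.comp_mem hpq hqr f hf g hg, Idc.map_comp g f⟩

/-- An isomorphism of diagrams: a family of isomorphisms `equiv p` under which the arrows of `D`
correspond exactly to those of `E`. (For join-semilattices, and for lattices, an isomorphism is
the same as an order isomorphism. For commutative diagrams this is a natural isomorphism.) -/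
structure SemilatDiagram.Iso (D : SemilatDiagram.{u} P) (E : SemilatDiagram.{v} P) where
  equiv : ∀ p, D.obj p ≃o E.obj p
  arrows_iff : ∀ {p q : P} (h : p ≤ q) (g : SupBotHom (E.obj p) (E.obj q)),
    g ∈ E.arrows h ↔ ∃ f ∈ D.arrows h, ∀ x, g (equiv p x) = equiv q (f x)

end Diagrams

/-! ### Abelian ℓ-groups given by generators and relations -/

/-- Terms in the similarity type `(0, +, -, ∨, ∧)` of ℓ-groups, with variables from `X`. -/
inductive LTerm (X : Type u) : Type u
  | var : X → LTerm X
  | zero : LTerm X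
  | add : LTerm X → LTerm X → LTerm X
  | neg : LTerm X → LTerm X
  | sup : LTerm X → LTerm X → LTerm X
  | inf : LTerm X → LTerm X → LTerm X

/-- The value of a term in an ℓ-group under an assignment of the variables. -/
def LTerm.eval {X : Type u} {G : Type v} [AddGroup G] [Lattice G] (x : X → G) : LTerm X → G
  | .var i => x i
  | .zero => 0
  | .add s t => s.eval x + t.eval x
  | .neg t => -t.eval x
  | .sup s t => s.eval x ⊔ t.eval x
  | .inf s t => s.eval x ⊓ t.eval x

/-- The congruence on terms generated by the identities of Abelian ℓ-groups together with the
relations `s = t` for all `s`, `t` with `R s t`. -/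
inductive PresRel {X : Type u} (R : LTerm X → LTerm X → Prop) : LTerm X → LTerm X → Prop
  | rel {s t} : R s t → PresRel R s t
  | refl (s) : PresRel R s s
  | symm {s t} : PresRel R s t → PresRel R t s
  | trans {s t r} : PresRel R s t → PresRel R t r → PresRel R s r
  | add_congr {s s' t t'} : PresRel R s s' → PresRel R t t' → PresRel R (.add s t) (.add s' t')
  | neg_congr {s s'} : PresRel R s s' → PresRel R (.neg s) (.neg s')
  | sup_congr {s s' t t'} : PresRel R s s' → PresRel R t t' → PresRel R (.sup s t) (.sup s' t')
  | inf_congr {s s' t t'} : PresRel R s s' → PresRel R t t' → PresRel R (.inf s t) (.inf s' t')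
  | add_assoc (s t r) : PresRel R (.add (.add s t) r) (.add s (.add t r))
  | add_comm (s t) : PresRel R (.add s t) (.add t s)
  | zero_add (s) : PresRel R (.add .zero s) s
  | neg_add_cancel (s) : PresRel R (.add (.neg s) s) .zero
  | sup_assoc (s t r) : PresRel R (.sup (.sup s t) r) (.sup s (.sup t r))
  | sup_comm (s t) : PresRel R (.sup s t) (.sup t s)
  | inf_assoc (s t r) : PresRel R (.inf (.inf s t) r) (.inf s (.inf t r))
  | inf_comm (s t) : PresRel R (.inf s t) (.inf t s)
  | sup_inf_self (s t) : PresRel R (.sup s (.inf s t)) s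
  | inf_sup_self (s t) : PresRel R (.inf s (.sup s t)) s
  | add_sup (s t r) : PresRel R (.add s (.sup t r)) (.sup (.add s t) (.add s r))

/-- The setoid of `PresRel R`. -/
def presSetoid {X : Type u} (R : LTerm X → LTerm X → Prop) : Setoid (LTerm X) where
  r := PresRel R
  iseqv := ⟨.refl, .symm, .trans⟩

/-- The Abelian ℓ-group defined by the generators in `X` and the relations in `R`. -/
def Presented {X : Type u} (R : LTerm X → LTerm X → Prop) : Type u := Quotient (presSetoid R)

namespace Presented

variable {X : Type u} {R : LTerm X → LTerm X → Prop}

/-- The class of a term. -/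
def mk (R : LTerm X → LTerm X → Prop) (t : LTerm X) : Presented R := Quotient.mk _ t

/-- The generator indexed by `i`. -/
def gen (R : LTerm X → LTerm X → Prop) (i : X) : Presented R := mk R (.var i)

theorem sound {s t : LTerm X} (h : PresRel R s t) : mk R s = mk R t := Quotient.sound h

theorem mk_surjective (x : Presented R) : ∃ t, mk R t = x := Quotient.exists_rep x

instance : Zero (Presented R) := ⟨mk R .zero⟩

instance : Add (Presented R) :=
  ⟨Quotient.map₂ .add fun _ _ h _ _ h' => PresRel.add_congr h h'⟩

instance : Neg (Presented R) := ⟨Quotient.map .neg fun _ _ h => PresRel.neg_congr h⟩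

instance : AddCommGroup (Presented R) where
  add_assoc := by
    rintro ⟨s⟩ ⟨t⟩ ⟨r⟩
    exact sound (.add_assoc s t r)
  zero_add := by
    rintro ⟨s⟩
    exact sound (.zero_add s)
  add_zero := by
    rintro ⟨s⟩
    exact sound ((PresRel.add_comm _ _).trans (.zero_add s))
  add_comm := by
    rintro ⟨s⟩ ⟨t⟩
    exact sound (.add_comm s t)
  neg_add_cancel := by
    rintro ⟨s⟩
    exact sound (.neg_add_cancel s)
  nsmul := nsmulRec
  zsmul := zsmulRec

instance : Lattice (Presented R) :=
  letI : Max (Presented R) :=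
    ⟨Quotient.map₂ .sup fun _ _ h _ _ h' => PresRel.sup_congr h h'⟩
  letI : Min (Presented R) :=
    ⟨Quotient.map₂ .inf fun _ _ h _ _ h' => PresRel.inf_congr h h'⟩
  Lattice.mk'
  (by
    rintro ⟨s⟩ ⟨t⟩
    exact sound (.sup_comm s t))
  (by
    rintro ⟨s⟩ ⟨t⟩ ⟨r⟩
    exact sound (.sup_assoc s t r))
  (by
    rintro ⟨s⟩ ⟨t⟩
    exact sound (.inf_comm s t))
  (by
    rintro ⟨s⟩ ⟨t⟩ ⟨r⟩
    exact sound (.inf_assoc s t r))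
  (by
    rintro ⟨s⟩ ⟨t⟩
    exact sound (.sup_inf_self s t))
  (by
    rintro ⟨s⟩ ⟨t⟩
    exact sound (.inf_sup_self s t))

theorem add_sup' (x y z : Presented R) : x + (y ⊔ z) = (x + y) ⊔ (x + z) := by
  obtain ⟨s⟩ := x
  obtain ⟨t⟩ := y
  obtain ⟨r⟩ := z
  exact sound (.add_sup s t r)

instance : AddLeftMono (Presented R) where
  elim x y z h := by
    change x + y ≤ x + z
    have h' : y ⊔ z = z := sup_eq_right.2 h
    rw [← sup_eq_right, ← add_sup', h']

instance : AddRightMono (Presented R) where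
  elim x y z h := by
    change y + x ≤ z + x
    rw [add_comm y, add_comm z]
    exact add_le_add_right h x

section lift

variable {G : Type v} [AddCommGroup G] [Lattice G] [AddLeftMono G]

theorem eval_eq_of_rel (x : X → G) (hx : ∀ s t, R s t → s.eval x = t.eval x)
    {s t : LTerm X} (h : PresRel R s t) : s.eval x = t.eval x := by
  induction h with
  | rel h => exact hx _ _ h
  | refl => rfl
  | symm _ ih => exact ih.symm
  | trans _ _ ih ih' => exact ih.trans ih'
  | add_congr _ _ ih ih' => simp only [LTerm.eval, ih, ih']
  | neg_congr _ ih => simp only [LTerm.eval, ih]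
  | sup_congr _ _ ih ih' => simp only [LTerm.eval, ih, ih']
  | inf_congr _ _ ih ih' => simp only [LTerm.eval, ih, ih']
  | add_assoc => exact _root_.add_assoc _ _ _
  | add_comm => exact _root_.add_comm _ _
  | zero_add => exact _root_.zero_add _
  | neg_add_cancel => exact _root_.neg_add_cancel _
  | sup_assoc => exact _root_.sup_assoc _ _ _
  | sup_comm => exact _root_.sup_comm _ _
  | inf_assoc => exact _root_.inf_assoc _ _ _
  | inf_comm => exact _root_.inf_comm _ _
  | sup_inf_self => exact _root_.sup_inf_self
  | inf_sup_self => exact _root_.inf_sup_self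
  | add_sup => exact _root_.add_sup _ _ _

/-- The ℓ-homomorphism to an Abelian ℓ-group `G` that extends an assignment of the generators
satisfying the relations. -/
def lift (x : X → G) (hx : ∀ s t, R s t → s.eval x = t.eval x) : LHom (Presented R) G where
  toFun := Quotient.lift (LTerm.eval x) fun _ _ h => eval_eq_of_rel x hx h
  map_zero' := rfl
  map_add' := by
    rintro ⟨s⟩ ⟨t⟩
    rfl
  map_sup' := by
    rintro ⟨s⟩ ⟨t⟩
    rfl
  map_inf' := by
    rintro ⟨s⟩ ⟨t⟩
    rfl

@[simp] theorem lift_gen (x : X → G) (hx : ∀ s t, R s t → s.eval x = t.eval x) (i : X) :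
    lift x hx (gen R i) = x i := rfl

end lift

end Presented

/-! ### The diagram `A` -/

/-- Names of the generators `a`, `aPrime`, `b`, `c`. -/
inductive Gen : Type
  | a | aPrime | b | c

/-- The relations `0 ≤ a ≤ aPrime ≤ 2a`, `0 ≤ b`, `0 ≤ c`, where `s ≤ t` is written `s ∧ t = s`. -/
inductive GenRel : LTerm Gen → LTerm Gen → Prop
  | zero_le_a : GenRel (.inf .zero (.var .a)) .zero
  | a_le_aPrime : GenRel (.inf (.var .a) (.var .aPrime)) (.var .a)
  | aPrime_le_two_a : GenRel (.inf (.var .aPrime) (.add (.var .a) (.var .a))) (.var .aPrime)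
  | zero_le_b : GenRel (.inf .zero (.var .b)) .zero
  | zero_le_c : GenRel (.inf .zero (.var .c)) .zero

/-- The Abelian ℓ-group with generators `a`, `aPrime`, `b`, `c` and relations
`0 ≤ a ≤ aPrime ≤ 2a`, `0 ≤ b`, `0 ≤ c`. -/
abbrev A123 : Type := Presented GenRel

namespace A123

/-- The generator `a`. -/
def a : A123 := Presented.gen GenRel .a
/-- The generator written `a'` in the mathematics. -/
def aPrime : A123 := Presented.gen GenRel .aPrime
/-- The generator `b`. -/
def b : A123 := Presented.gen GenRel .b
/-- The generator `c`. -/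
def c : A123 := Presented.gen GenRel .c

theorem zero_le_a : 0 ≤ a := inf_eq_left.1 (Presented.sound (.rel .zero_le_a))
theorem a_le_aPrime : a ≤ aPrime := inf_eq_left.1 (Presented.sound (.rel .a_le_aPrime))
theorem aPrime_le_two_a : aPrime ≤ a + a := inf_eq_left.1 (Presented.sound (.rel .aPrime_le_two_a))
theorem zero_le_b : 0 ≤ b := inf_eq_left.1 (Presented.sound (.rel .zero_le_b))
theorem zero_le_c : 0 ≤ c := inf_eq_left.1 (Presented.sound (.rel .zero_le_c))

/-- The endomorphism with `a ↦ aPrime`, `aPrime ↦ aPrime`, `b ↦ b`, `c ↦ c`. -/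
def shift : LHom A123 A123 :=
  Presented.lift (fun | .a => aPrime | .aPrime => aPrime | .b => b | .c => c) (by
    have h : 0 ≤ aPrime := zero_le_a.trans a_le_aPrime
    rintro _ _ (_ | _ | _ | _ | _)
    · exact inf_eq_left.2 h
    · exact inf_eq_left.2 le_rfl
    · exact inf_eq_left.2 (le_add_of_nonneg_right h)
    · exact inf_eq_left.2 zero_le_b
    · exact inf_eq_left.2 zero_le_c)

theorem shift_a : shift a = aPrime := rfl

/-- The index set: the powerset of a three-element set, ordered by inclusion. The elements
`0`, `1`, `2` of `Fin 3` stand for `1`, `2`, `3`. -/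
abbrev Cube : Type := Finset (Fin 3)

/-- The generators of the `p`-th vertex of the diagram:
`∅` for `∅`, `{a}` for `1`, `{b}` for `2`, `{c}` for `3`, `{a, b}` for `12`, `{aPrime, c}` for `13`,
`{b, c}` for `23`, and `{a, aPrime, b, c}` for `123`. -/
def vertexGens (p : Cube) : Set A123 :=
  {x | (x = a ∧ 0 ∈ p ∧ p ≠ {0, 2}) ∨ (x = aPrime ∧ {0, 2} ⊆ p) ∨ (x = b ∧ 1 ∈ p) ∨ (x = c ∧ 2 ∈ p)}

/-- The `p`-th vertex of the diagram: the ℓ-subgroup of `A123` generated by `vertexGens p`. -/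
def vertex (p : Cube) : AddSubgroup A123 where
  carrier := lClosure A123 (vertexGens p)
  zero_mem' := ((lClosure A123).isClosed_closure (vertexGens p)).zero_mem
  add_mem' hx hy := ((lClosure A123).isClosed_closure (vertexGens p)).add_mem _ hx _ hy
  neg_mem' hx := ((lClosure A123).isClosed_closure (vertexGens p)).neg_mem _ hx

theorem isLSubgroup_vertex (p : Cube) : IsLSubgroup (vertex p : Set A123) :=
  (lClosure A123).isClosed_closure (vertexGens p)

instance (p : Cube) : Lattice (vertex p) :=
  Subtype.lattice (fun x y hx hy => (isLSubgroup_vertex p).sup_mem x hx y hy)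
    (fun x y hx hy => (isLSubgroup_vertex p).inf_mem x hx y hy)

instance (p : Cube) : AddLeftMono (vertex p) where
  elim x y z h := by
    change (x : A123) + y ≤ x + z
    exact add_le_add_right (α := A123) h x

instance (p : Cube) : AddRightMono (vertex p) where
  elim x y z h := by
    change (y : A123) + x ≤ z + x
    exact add_le_add_left (α := A123) h x

theorem subset_vertex (p : Cube) : vertexGens p ⊆ vertex p := (lClosure A123).le_closure _

theorem a_mem_vertex : a ∈ vertex {0} := subset_vertex _ (Or.inl ⟨rfl, by decide, by decide⟩)

/-- The arrows of the diagram. All of them are inclusion maps, except that the only arrow from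
`1` to `13` is the ℓ-homomorphism sending `a` to `aPrime`, and that there are two arrows from `1` to
`123`, the inclusion and the ℓ-homomorphism sending `a` to `aPrime`. -/
def diagArrows (p q : Cube) : Set (LHom (vertex p) (vertex q)) :=
  {f | (¬ (p = {0} ∧ q = {0, 2}) ∧ ∀ x, (f x : A123) = x) ∨
    (({0, 2} ⊆ q) ∧ ∃ h : p = {0}, (f ⟨a, h ▸ a_mem_vertex⟩ : A123) = aPrime)}

/-- The restriction of an endomorphism of `A123` to vertices. -/
def restrict (f : LHom A123 A123) {p q : Cube} (h : ∀ x ∈ vertexGens p, f x ∈ vertex q) :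
    LHom (vertex p) (vertex q) where
  toFun x := ⟨f x, ClosureOperator.closure_min (c := lClosure A123) (y := f ⁻¹' vertex q) h
    ((isLSubgroup_vertex q).preimage f) x.2⟩
  map_zero' := Subtype.ext (map_zero f)
  map_add' x y := Subtype.ext (map_add f x.1 y.1)
  map_sup' x y := Subtype.ext (map_sup f x.1 y.1)
  map_inf' x y := Subtype.ext (map_inf f x.1 y.1)

theorem vertexGens_mono {p q : Cube} (hpq : p ≤ q) (h : ¬ (p = {0} ∧ q = {0, 2})) :
    vertexGens p ⊆ vertexGens q := by
  rintro x (⟨rfl, h0, hp⟩ | ⟨rfl, h02⟩ | ⟨rfl, h1⟩ | ⟨rfl, h2⟩)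
  · refine Or.inl ⟨rfl, hpq h0, fun hq => ?_⟩
    subst hq
    revert p
    decide
  · exact Or.inr (Or.inl ⟨rfl, h02.trans hpq⟩)
  · exact Or.inr (Or.inr (Or.inl ⟨rfl, hpq h1⟩))
  · exact Or.inr (Or.inr (Or.inr ⟨rfl, hpq h2⟩))

theorem diagArrows_nonempty {p q : Cube} (hpq : p ≤ q) : (diagArrows p q).Nonempty := by
  by_cases h : p = {0} ∧ q = {0, 2}
  · obtain ⟨rfl, rfl⟩ := h
    refine ⟨restrict shift ?_, Or.inr ⟨subset_rfl, rfl, shift_a⟩⟩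
    rintro x (⟨rfl, -, -⟩ | ⟨-, h⟩ | ⟨-, h⟩ | ⟨-, h⟩)
    · rw [shift_a]
      exact subset_vertex _ (Or.inr (Or.inl ⟨rfl, subset_rfl⟩))
    all_goals exact absurd h (by decide)
  · exact ⟨restrict (LHom.id A123) fun x hx => subset_vertex q (vertexGens_mono hpq h hx),
      Or.inl ⟨h, fun _ => rfl⟩⟩

theorem comp_mem_diagArrows {p q r : Cube} (hpq : p ≤ q) (hqr : q ≤ r) (f) (hf : f ∈ diagArrows p q)
    (g) (hg : g ∈ diagArrows q r) : g.comp f ∈ diagArrows p r := by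
  rcases hg with ⟨hg, hg'⟩ | ⟨hr, rfl, hg'⟩
  · rcases hf with ⟨hf, hf'⟩ | ⟨hq, rfl, hf'⟩
    · refine Or.inl ⟨?_, fun x => (hg' _).trans (hf' x)⟩
      clear hg' hf' f g
      revert p q r
      decide
    · exact Or.inr ⟨hq.trans hqr, rfl, (hg' _).trans hf'⟩
  · rcases hf with ⟨hf, hf'⟩ | ⟨hq, _⟩
    · obtain rfl | rfl := Finset.subset_singleton_iff.1 hpq
      · left
        refine ⟨by simp, fun x => ?_⟩
        have hx : x = 0 := by
          have h0 : IsLSubgroup ({0} : Set A123) :=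
            { zero_mem := rfl
              add_mem := by simp
              neg_mem := by simp
              sup_mem := by simp
              inf_mem := by simp }
          refine Subtype.ext ((ClosureOperator.closure_min (c := lClosure A123) ?_ h0) x.2)
          rintro y (⟨-, h, -⟩ | ⟨-, h⟩ | ⟨-, h⟩ | ⟨-, h⟩) <;> exact absurd h (by decide)
        subst hx
        simp
      · refine Or.inr ⟨hr, rfl, ?_⟩
        have : f ⟨a, a_mem_vertex⟩ = ⟨a, a_mem_vertex⟩ := Subtype.ext (hf' _)
        rw [LHom.comp_apply, this]
        exact hg'
    · exact absurd hq (by decide)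

end A123

/-- The non-commutative diagram `A` of Abelian ℓ-groups indexed by the cube. -/
abbrev diagA : LGroupDiagram.{0} A123.Cube where
  obj p := A123.vertex p
  arrows {p q} _ := A123.diagArrows p q
  arrows_nonempty h := A123.diagArrows_nonempty h
  id_mem p := Or.inl ⟨by rintro ⟨rfl, h⟩; exact absurd h (by decide), fun _ => rfl⟩
  comp_mem := A123.comp_mem_diagArrows

namespace A123

theorem exists_zsmul_of_mem_vertex (x : vertex {0}) :
    ∃ n : ℤ, x = n • (⟨a, a_mem_vertex⟩ : vertex {0}) := by
  have hmono : ∀ m n : ℤ, m ≤ n → m • a ≤ n • a := fun m n h => by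
    obtain ⟨k, rfl⟩ := Int.le.dest h
    rw [add_zsmul, natCast_zsmul]
    exact le_add_of_nonneg_right (nsmul_nonneg zero_le_a k)
  have h : IsLSubgroup {y : A123 | ∃ n : ℤ, y = n • a} :=
    { zero_mem := ⟨0, by simp⟩
      add_mem := by
        rintro _ ⟨m, rfl⟩ _ ⟨n, rfl⟩
        exact ⟨m + n, (add_zsmul _ _ _).symm⟩
      neg_mem := by
        rintro _ ⟨m, rfl⟩
        exact ⟨-m, (neg_zsmul _ _).symm⟩
      sup_mem := by
        rintro _ ⟨m, rfl⟩ _ ⟨n, rfl⟩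
        rcases le_total m n with h | h
        · exact ⟨n, sup_eq_right.2 (hmono _ _ h)⟩
        · exact ⟨m, sup_eq_left.2 (hmono _ _ h)⟩
      inf_mem := by
        rintro _ ⟨m, rfl⟩ _ ⟨n, rfl⟩
        rcases le_total m n with h | h
        · exact ⟨m, inf_eq_left.2 (hmono _ _ h)⟩
        · exact ⟨n, inf_eq_right.2 (hmono _ _ h)⟩ }
  obtain ⟨n, hn⟩ : ∃ n : ℤ, (x : A123) = n • a := by
    refine (ClosureOperator.closure_min (c := lClosure A123) ?_ h) x.2
    rintro y (⟨rfl, -, -⟩ | ⟨-, h⟩ | ⟨-, h⟩ | ⟨-, h⟩)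
    · exact ⟨1, by simp⟩
    all_goals exact absurd h (by decide)
  exact ⟨n, Subtype.ext hn⟩

theorem idc_map_le {q : Cube} (f g : LHom (vertex {0}) (vertex q))
    (h0 : 0 ≤ f ⟨a, a_mem_vertex⟩)
    (h : f ⟨a, a_mem_vertex⟩ ≤ g ⟨a, a_mem_vertex⟩ + g ⟨a, a_mem_vertex⟩) (S : Idc (vertex {0})) :
    Idc.map f S ≤ Idc.map g S := by
  have hcl : IsLIdeal (lIdealClosure (vertex q) (g '' S.1)) :=
    (lIdealClosure (vertex q)).isClosed_closure _
  refine ClosureOperator.closure_min (c := lIdealClosure (vertex q)) ?_ hcl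
  rintro _ ⟨x, hx, rfl⟩
  have hg : g x ∈ lIdealClosure (vertex q) (g '' S.1) :=
    (lIdealClosure (vertex q)).le_closure _ ⟨x, hx, rfl⟩
  have key : ∀ m : ℕ, m • g ⟨a, a_mem_vertex⟩ ∈ lIdealClosure (vertex q) (g '' S.1) →
      m • f ⟨a, a_mem_vertex⟩ ∈ lIdealClosure (vertex q) (g '' S.1) := fun m hm => by
    refine hcl.convex 0 hcl.zero_mem _ (hcl.add_mem _ hm _ hm) _ (nsmul_nonneg h0 m) ?_
    rw [← nsmul_add]
    exact nsmul_le_nsmul_right h m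
  obtain ⟨n, rfl⟩ := exists_zsmul_of_mem_vertex x
  rw [map_zsmul] at hg ⊢
  obtain ⟨m, rfl | rfl⟩ := n.eq_nat_or_neg
  · rw [natCast_zsmul] at hg ⊢
    exact key m hg
  · rw [neg_zsmul, natCast_zsmul] at hg ⊢
    exact hcl.neg_mem _ (key m (by simpa using hcl.neg_mem _ hg))

theorem idc_map_eq {p q : Cube} (f : LHom (vertex p) (vertex q)) (hf : f ∈ diagArrows p q)
    (g : LHom (vertex p) (vertex q)) (hg : g ∈ diagArrows p q) : Idc.map f = Idc.map g := by
  by_cases hp : p = {0}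
  · subst hp
    have key : ∀ f ∈ diagArrows {0} q, (f ⟨a, a_mem_vertex⟩ : A123) = a ∨
        (f ⟨a, a_mem_vertex⟩ : A123) = aPrime := by
      rintro f (⟨-, hf⟩ | ⟨-, _, hf⟩)
      · exact Or.inl (hf _)
      · exact Or.inr hf
    have h0 := zero_le_a
    have h1 := a_le_aPrime
    have hle : ∀ x y : A123, (x = a ∨ x = aPrime) → (y = a ∨ y = aPrime) →
        0 ≤ x ∧ x ≤ y + y := by
      rintro x y (rfl | rfl) (rfl | rfl)
      · exact ⟨h0, le_add_of_nonneg_left h0⟩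
      · exact ⟨h0, h1.trans (le_add_of_nonneg_left (h0.trans h1))⟩
      · exact ⟨h0.trans h1, aPrime_le_two_a⟩
      · exact ⟨h0.trans h1, le_add_of_nonneg_left (h0.trans h1)⟩
    have hfg := hle _ _ (key f hf) (key g hg)
    have hgf := hle _ _ (key g hg) (key f hf)
    exact DFunLike.ext _ _ fun S => le_antisymm (idc_map_le f g hfg.1 hfg.2 S)
      (idc_map_le g f hgf.1 hgf.2 S)
  · have key : ∀ f ∈ diagArrows p q, ∀ x, (f x : A123) = x := by
      rintro f (⟨-, hf⟩ | ⟨-, hf, -⟩)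
      · exact hf
      · exact absurd hf hp
    congr 1
    exact DFunLike.ext _ _ fun x => Subtype.ext ((key f hf x).trans (key g hg x).symm)

end A123

/-- Although `diagA` is not commutative, its image under `Idc` is. -/
theorem diagA_idc_isCommutative : diagA.idc.IsCommutative := by
  intro p q h
  obtain ⟨f, hf⟩ := A123.diagArrows_nonempty h
  refine ⟨Idc.map f, Set.Subset.antisymm ?_ (Set.singleton_subset_iff.2 ⟨f, hf, rfl⟩)⟩
  rintro _ ⟨g, hg, rfl⟩
  exact A123.idc_map_eq g hg f hf

end LatGrp

/-! Suppose such a commutative diagram `G` exists, and send each element `x` of `G_p` to the ideal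
of `A_p` corresponding to the convex ℓ-subgroup (or ℓ-ideal) generated by `x`. Ideals of `A_p` are
studied through their supports: the real points of `A123` at which some member does not vanish. Read
"`x > y` at a point" as "the point lies in the support of the ideal attached to the positive part of
`x - y`". Then `x > y` and `y > x` never hold at the same point, and `x > z` forces `x > y` or `y >
z`. The first of these rests on orthogonal elements generating subobjects with zero intersection,
which holds for convex ℓ-subgroups of every ℓ-group, and for ℓ-ideals of representable ones.

Lift the ideals generated by `a`, `b`, `c` to positive elements `α`, `β`, `γ`. In the vertex 12, `α
> β` on the ray of slope 0 and `β > α` on the ray of infinite slope. These two conditions are open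
and disjoint, so by connectedness some slope `s > 0` satisfies neither: `α` and `β` tie there
(`exists_not_hits`). In the vertex 13, where `α` is seen through `aPrime`, the slopes with `γ > α`
are not closed under halving, so `γ > α` at some `t` but not at `t / 2`
(`exists_hits_not_hits_half`).

Now compare the points `(a, aPrime, b, c) = (1, 1, s, t)` and `(1, 2, s, t)`, both allowed by `a ≤
aPrime ≤ 2a`. They agree on 12 and on 23, while on 13 they have slopes `t` and `t / 2`. At the first
point `γ > α`, hence `γ > β` by the tie. This is a condition on 23, so it holds at the second point,
where the tie gives `γ > α` again: a contradiction at slope `t / 2`. Commutativity of `G` ensures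
that the three comparisons, made in three different faces, concern the same three elements of the
top vertex. -/

namespace LatGrp

/-! ### Orthogonality in ℓ-groups -/

section LGroup

variable {G : Type u} {H : Type v} [AddGroup G] [Lattice G] [AddGroup H] [Lattice H]

theorem LHom.map_sub_sup_zero (f : LHom G H) (x y : G) : f ((x - y) ⊔ 0) = (f x - f y) ⊔ 0 := by
  simp

theorem le_sub_sup_zero_add [AddRightMono G] (x y : G) : x ≤ ((x - y) ⊔ 0) + y := by
  rw [← sub_le_iff_le_add]
  exact le_sup_left

theorem IsLIdeal.ker (f : LHom G H) [AddLeftMono H] [AddRightMono H] :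
    IsLIdeal {x : G | f x = 0} := by
  have h0 : IsLIdeal ({0} : Set H) :=
    { zero_mem := rfl
      add_mem := by simp
      neg_mem := by simp
      sup_mem := by simp
      inf_mem := by simp
      convex := by
        rintro _ rfl _ rfl y h1 h2
        exact le_antisymm h2 h1
      normal := by simp }
  exact h0.preimage f

/-- In each totally ordered quotient one of `p`, `q` vanishes, and the ideal that it generates
vanishes with it. In a general ℓ-group conjugation can destroy orthogonality, hence the appeal to
representability. -/
theorem IsRepresentable.eq_zero_of_mem_lIdealClosure (hG : IsRepresentable G) {p q x : G}
    (hpq : p ⊓ q = 0) (hp : x ∈ lIdealClosure G {p}) (hq : x ∈ lIdealClosure G {q}) : x = 0 := by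
  obtain ⟨I, T, _, _, _, _, π, -, hπ⟩ := hG
  refine hπ x 0 fun i => ?_
  have key : ∀ s : G, π i s = 0 → x ∈ lIdealClosure G {s} → π i x = 0 := fun s hs hx =>
    ClosureOperator.closure_min (c := lIdealClosure G) (Set.singleton_subset_iff.2 hs)
      (IsLIdeal.ker (π i)) hx
  have h : π i p ⊓ π i q = 0 := by rw [← map_inf, hpq, map_zero]
  rw [map_zero]
  rcases le_total (π i p) (π i q) with h' | h'
  · exact key p (by rwa [inf_eq_left.2 h'] at h) hp
  · exact key q (by rwa [inf_eq_right.2 h'] at h) hq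

variable [AddLeftMono G] [AddRightMono G]

theorem sub_sup_zero_inf_sub_sup_zero (x y : G) : ((x - y) ⊔ 0) ⊓ ((y - x) ⊔ 0) = 0 := by
  have h := posPart_inf_negPart_eq_zero (x - y)
  rwa [posPart_def, negPart_def, neg_sub] at h

theorem sub_sup_zero_le_add (x y z : G) : (x - z) ⊔ 0 ≤ ((x - y) ⊔ 0) + ((y - z) ⊔ 0) := by
  refine sup_le ?_ (add_nonneg le_sup_right le_sup_right)
  rw [← sub_add_sub_cancel x y z]
  exact add_le_add le_sup_left le_sup_left

theorem add_inf_eq_zero {x y z : G} (hx : 0 ≤ x) (hz : 0 ≤ z) (hxz : x ⊓ z = 0)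
    (hyz : y ⊓ z = 0) : (x + y) ⊓ z = 0 := by
  have hy : 0 ≤ y := hyz ▸ inf_le_left
  refine le_antisymm ?_ (le_inf (add_nonneg hx hy) hz)
  have h : (x + y) ⊓ z ≤ x := by
    calc (x + y) ⊓ z ≤ (x + y) ⊓ (x + z) := inf_le_inf_left _ (le_add_of_nonneg_left hx)
      _ = x := by rw [← add_inf, hyz, add_zero]
  exact hxz ▸ le_inf h inf_le_right

/-- The elements bounded above and below by elements orthogonal to `q` form a convex
ℓ-subgroup. -/
theorem isConvexLSubgroup_polar {q : G} (hq : 0 ≤ q) :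
    IsConvexLSubgroup {x : G | ∃ r, r ⊓ q = 0 ∧ -r ≤ x ∧ x ≤ r} := by
  have nn : ∀ {r : G}, r ⊓ q = 0 → 0 ≤ r := fun h => h ▸ inf_le_left
  have add : ∀ {r s : G}, r ⊓ q = 0 → s ⊓ q = 0 → (r + s) ⊓ q = 0 :=
    fun hr hs => add_inf_eq_zero (nn hr) hq hr hs
  refine
    { zero_mem := ⟨0, inf_eq_left.2 hq, by simp, le_rfl⟩
      add_mem := ?_
      neg_mem := ?_
      sup_mem := ?_
      inf_mem := ?_
      convex := ?_ }
  · rintro x ⟨r, hr, h1, h2⟩ y ⟨s, hs, h3, h4⟩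
    -- Addition need not commute: the upper bound needs `r + s` and the lower bound needs `s + r`,
    -- and `r + s + r` dominates both.
    refine ⟨(r + s) + r, add (add hr hs) hr, ?_, ?_⟩
    · refine le_trans ?_ (add_le_add h1 h3)
      rw [← neg_add_rev, neg_le_neg_iff, add_assoc]
      exact le_add_of_nonneg_left (nn hr)
    · exact (add_le_add h2 h4).trans (le_add_of_nonneg_right (nn hr))
  · rintro x ⟨r, hr, h1, h2⟩
    exact ⟨r, hr, neg_le_neg_iff.2 h2, neg_le.1 h1⟩
  · rintro x ⟨r, hr, h1, h2⟩ y ⟨s, hs, h3, h4⟩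
    refine ⟨r + s, add hr hs, ?_, sup_le ?_ ?_⟩
    · exact le_sup_of_le_left
        ((neg_le_neg_iff.2 (le_add_of_nonneg_right (nn hs))).trans h1)
    · exact h2.trans (le_add_of_nonneg_right (nn hs))
    · exact h4.trans (le_add_of_nonneg_left (nn hr))
  · rintro x ⟨r, hr, h1, h2⟩ y ⟨s, hs, h3, h4⟩
    refine ⟨r + s, add hr hs, le_inf ?_ ?_, ?_⟩
    · exact (neg_le_neg_iff.2 (le_add_of_nonneg_right (nn hs))).trans h1
    · exact (neg_le_neg_iff.2 (le_add_of_nonneg_left (nn hr))).trans h3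
    · exact inf_le_of_left_le (h2.trans (le_add_of_nonneg_right (nn hs)))
  · rintro x ⟨r, hr, h1, h2⟩ z ⟨s, hs, h3, h4⟩ y hxy hyz
    refine ⟨r + s, add hr hs, ?_, ?_⟩
    · exact (neg_le_neg_iff.2 (le_add_of_nonneg_right (nn hs))).trans (h1.trans hxy)
    · exact hyz.trans (h4.trans (le_add_of_nonneg_left (nn hr)))

/-- Two passes through the polar: `x` lies between `-r` and `r` for some `r` orthogonal to `q`,
then, as a member of the subgroup generated by `q`, between `-s` and `s` for some `s` orthogonal to
`r`. Hence `x` is squeezed by `s ⊓ r = 0`. -/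
theorem eq_zero_of_mem_convexLClosure {p q x : G} (hpq : p ⊓ q = 0)
    (hp : x ∈ convexLClosure G {p}) (hq : x ∈ convexLClosure G {q}) : x = 0 := by
  have hp0 : 0 ≤ p := hpq ▸ inf_le_left
  have hq0 : 0 ≤ q := hpq ▸ inf_le_right
  have key : ∀ {s t : G}, 0 ≤ s → 0 ≤ t → s ⊓ t = 0 →
      convexLClosure G {s} ⊆ {x : G | ∃ r, r ⊓ t = 0 ∧ -r ≤ x ∧ x ≤ r} := by
    intro s t hs ht hst
    refine ClosureOperator.closure_min (c := convexLClosure G) ?_ (isConvexLSubgroup_polar ht)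
    exact Set.singleton_subset_iff.2 ⟨s, hst, (neg_nonpos.2 hs).trans hs, le_rfl⟩
  obtain ⟨r, hr, h1, h2⟩ := key hp0 hq0 hpq hp
  have hr0 : 0 ≤ r := hr ▸ inf_le_left
  obtain ⟨s, hs, h3, h4⟩ := key hq0 hr0 (inf_comm q r ▸ hr) hq
  refine le_antisymm ((le_inf h4 h2).trans hs.le) ?_
  rw [← neg_nonpos]
  exact (le_inf (neg_le.1 h3) (neg_le.1 h1)).trans hs.le

end LGroup

/-! ### Principal closed sets -/

namespace FGClosed

variable {α : Type u} {β : Type v} {cl : ClosureOperator (Set α)} {cl' : ClosureOperator (Set β)}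

variable (cl) in
/-- The closed set generated by one element. -/
def principal (x : α) : FGClosed cl := ⟨cl {x}, {x}, Set.finite_singleton x, rfl⟩

theorem mem_principal (x : α) : x ∈ (principal cl x).1 := cl.le_closure _ rfl

theorem principal_le {x : α} {S : FGClosed cl} (h : x ∈ S.1) : principal cl x ≤ S :=
  ClosureOperator.closure_min (Set.singleton_subset_iff.2 h) S.isClosed

theorem map_principal (f : α → β) (hf : ∀ T, cl'.IsClosed T → cl.IsClosed (f ⁻¹' T)) (x : α) :
    map f hf (principal cl x) = principal cl' (f x) := Subtype.ext <| by
  change cl' (f '' cl {x}) = cl' {f x}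
  rw [closure_image_closure f hf, Set.image_singleton]

variable {G : Type u} [AddGroup G] [Lattice G] {cl : ClosureOperator (Set G)}

theorem principal_le_sup (hcl : ∀ S, cl.IsClosed S → IsConvexLSubgroup S) {x y z : G}
    (hx : 0 ≤ x) (h : x ≤ y + z) : principal cl x ≤ principal cl y ⊔ principal cl z := by
  have hS := hcl _ (principal cl y ⊔ principal cl z).isClosed
  have hy := (le_sup_left : principal cl y ≤ principal cl y ⊔ principal cl z) (mem_principal y)
  have hz := (le_sup_right : principal cl z ≤ principal cl y ⊔ principal cl z) (mem_principal z)
  exact principal_le (hS.convex 0 hS.zero_mem _ (hS.add_mem _ hy _ hz) x hx h)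

/-- By convexity, a finite generating set can be replaced by one positive element of its closure
that bounds the absolute values of all the generators. -/
theorem exists_eq_principal [AddLeftMono G] [AddRightMono G]
    (hcl : ∀ S, cl.IsClosed S → IsConvexLSubgroup S) (S : FGClosed cl) : ∃ x, 0 ≤ x ∧ principal cl x = S := by
  obtain ⟨_, s, hs, rfl⟩ := S
  obtain ⟨x, hx0, hx, h⟩ : ∃ x, 0 ≤ x ∧ x ∈ cl s ∧ ∀ y ∈ s, -x ≤ y ∧ y ≤ x := by
    induction s, hs using Set.Finite.induction_on with
    | empty => exact ⟨0, le_rfl, (hcl _ (cl.isClosed_closure _)).zero_mem, by simp⟩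
    | @insert y s _ _ ih =>
      obtain ⟨x, hx0, hx, h⟩ := ih
      have hc := hcl _ (cl.isClosed_closure (insert y s))
      have hy : y ∈ cl (insert y s) := cl.le_closure _ (Set.mem_insert y s)
      have hx' : x ∈ cl (insert y s) := cl.monotone (Set.subset_insert y s) hx
      refine ⟨x ⊔ (y ⊔ -y), le_sup_of_le_left hx0,
        hc.sup_mem _ hx' _ (hc.sup_mem _ hy _ (hc.neg_mem _ hy)), ?_⟩
      rintro z (rfl | hz)
      · exact ⟨neg_le.1 (le_sup_of_le_right le_sup_right), le_sup_of_le_right le_sup_left⟩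
      · exact ⟨(neg_le_neg_iff.2 le_sup_left).trans (h z hz).1, le_sup_of_le_left (h z hz).2⟩
  refine ⟨x, hx0, le_antisymm (principal_le hx) ?_⟩
  have hc := hcl _ (principal cl x).isClosed
  refine ClosureOperator.closure_min (fun y hy => ?_) (principal cl x).isClosed
  exact hc.convex _ (hc.neg_mem _ (mem_principal x)) _ (mem_principal x) y (h y hy).1 (h y hy).2

end FGClosed

namespace A123

/-! ### Real points of `A123` -/

/-- The ℓ-homomorphism `A123 → ℝ` with prescribed values at the generators. -/
noncomputable def point (x x' y z : ℝ) (hx : 0 ≤ x) (hxx' : x ≤ x') (hx' : x' ≤ x + x)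
    (hy : 0 ≤ y) (hz : 0 ≤ z) : LHom A123 ℝ :=
  Presented.lift (fun | .a => x | .aPrime => x' | .b => y | .c => z) (by
    rintro _ _ (_ | _ | _ | _ | _)
    · exact inf_eq_left.2 hx
    · exact inf_eq_left.2 hxx'
    · exact inf_eq_left.2 hx'
    · exact inf_eq_left.2 hy
    · exact inf_eq_left.2 hz)

/-- The point with `a, aPrime ↦ |x|` and `b, c ↦ |y|`. -/
noncomputable def edgePoint (x y : ℝ) : LHom A123 ℝ :=
  point |x| |x| |y| |y| (abs_nonneg x) le_rfl (le_add_of_nonneg_left (abs_nonneg x)) (abs_nonneg y)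
    (abs_nonneg y)

/-- The point `φ` belongs to the support of the ℓ-ideal `S`. -/
def Hits (φ : LHom A123 ℝ) {p : Cube} (S : Idc (vertex p)) : Prop :=
  ∃ y ∈ S.1, φ (y : A123) ≠ 0

/-- The inclusion of a vertex. -/
def incl (p : Cube) : LHom (vertex p) A123 where
  toAddMonoidHom := (vertex p).subtype
  map_sup' _ _ := rfl
  map_inf' _ _ := rfl

/-- The kernel of a real point is an ℓ-ideal, so vanishing need only be tested on generators. -/
theorem hits_closure_iff (φ : LHom A123 ℝ) {p : Cube} (S : Idc (vertex p)) (s : Set (vertex p))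
    (hS : S.1 = lIdealClosure (vertex p) s) : Hits φ S ↔ ∃ y ∈ s, φ (y : A123) ≠ 0 := by
  refine ⟨fun ⟨y, hy, hφ⟩ => ?_,
    fun ⟨y, hy, hφ⟩ => ⟨y, hS ▸ (lIdealClosure (vertex p)).le_closure s hy, hφ⟩⟩
  by_contra! h
  rw [hS] at hy
  exact hφ (ClosureOperator.closure_min (c := lIdealClosure (vertex p)) h
    (IsLIdeal.ker (φ.comp (incl p))) hy)

theorem Hits.mono {φ : LHom A123 ℝ} {p : Cube} {S T : Idc (vertex p)} (h : Hits φ S)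
    (hST : S ≤ T) : Hits φ T :=
  let ⟨y, hy, hφ⟩ := h
  ⟨y, hST hy, hφ⟩

theorem Hits.of_sup {φ : LHom A123 ℝ} {p : Cube} {S T : Idc (vertex p)} (h : Hits φ (S ⊔ T)) :
    Hits φ S ∨ Hits φ T := by
  obtain ⟨y, hy | hy, hφ⟩ := (hits_closure_iff φ (S ⊔ T) (S.1 ∪ T.1) rfl).1 h
  · exact Or.inl ⟨y, hy, hφ⟩
  · exact Or.inr ⟨y, hy, hφ⟩

theorem not_hits_bot (φ : LHom A123 ℝ) (p : Cube) : ¬ Hits φ (⊥ : Idc (vertex p)) := by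
  rw [hits_closure_iff φ ⊥ ∅ rfl]
  simp

theorem hits_principal (φ : LHom A123 ℝ) {p : Cube} (x : vertex p) :
    Hits φ (FGClosed.principal (lIdealClosure (vertex p)) x) ↔ φ (x : A123) ≠ 0 := by
  rw [hits_closure_iff φ _ {x} rfl]
  simp

theorem hits_map_iff (φ : LHom A123 ℝ) {p q : Cube} (g : LHom (vertex p) (vertex q))
    (hg : ∀ x, (g x : A123) = x) (S : Idc (vertex p)) : Hits φ (Idc.map g S) ↔ Hits φ S := by
  rw [hits_closure_iff φ _ (g '' S.1) rfl]
  rw [Set.exists_mem_image]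
  simp only [hg, Hits]

/-- The meet of `|x|` and `|y|` lies in both ideals and stays nonzero at `φ`, because ℝ is totally
ordered. This turns disjointness of ideals into disjointness of supports. -/
theorem Hits.exists_ne_bot {φ : LHom A123 ℝ} {p : Cube} {S T : Idc (vertex p)} (hS : Hits φ S)
    (hT : Hits φ T) : ∃ U, U ≤ S ∧ U ≤ T ∧ U ≠ ⊥ := by
  obtain ⟨x, hx, hφx⟩ := hS
  obtain ⟨y, hy, hφy⟩ := hT
  have mem : ∀ (S : Idc (vertex p)) (x y : vertex p), x ∈ S.1 →
      (x ⊔ -x) ⊓ (y ⊔ -y) ∈ S.1 := fun S x y hx => by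
    have hc : IsConvexLSubgroup S.1 := IsLIdeal.toIsConvexLSubgroup (FGClosed.isClosed S)
    exact hc.convex 0 hc.zero_mem _ (hc.sup_mem _ hx _ (hc.neg_mem _ hx)) _
      (le_inf (abs_nonneg x) (abs_nonneg y)) inf_le_left
  refine ⟨FGClosed.principal _ ((x ⊔ -x) ⊓ (y ⊔ -y)), FGClosed.principal_le (mem S x y hx),
    FGClosed.principal_le (inf_comm (y ⊔ -y) _ ▸ mem T y x hy), fun h => ?_⟩
  refine not_hits_bot φ p (h ▸ (hits_principal φ _).2 ?_)
  change (φ.comp (incl p)) ((x ⊔ -x) ⊓ (y ⊔ -y)) ≠ 0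
  rw [map_inf, map_sup, map_sup, map_neg, map_neg]
  exact ne_of_gt (lt_inf_iff.2 ⟨abs_pos.2 hφx, abs_pos.2 hφy⟩)

/-- Positive scaling commutes with all ℓ-group operations, so an ideal of `A_p` sees only the ray
spanned by the values at the generators of `A_p`. Distinct points of `A123` thus become
indistinguishable at smaller vertices. -/
theorem hits_congr {φ ψ : LHom A123 ℝ} {p : Cube} {r : ℝ} (hr : 0 < r)
    (h : ∀ x ∈ vertexGens p, ψ x = r * φ x) (S : Idc (vertex p)) : Hits φ S ↔ Hits ψ S := by
  have hl : IsLSubgroup {x : A123 | ψ x = r * φ x} :=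
    { zero_mem := by simp
      add_mem := fun x hx y hy => by
        simp only [Set.mem_ofPred_eq] at *
        rw [map_add, map_add, hx, hy, mul_add]
      neg_mem := fun x hx => by
        simp only [Set.mem_ofPred_eq] at *
        rw [map_neg, map_neg, hx, mul_neg]
      sup_mem := fun x hx y hy => by
        simp only [Set.mem_ofPred_eq] at *
        rw [map_sup, map_sup, hx, hy, mul_max_of_nonneg _ _ hr.le]
      inf_mem := fun x hx y hy => by
        simp only [Set.mem_ofPred_eq] at *
        rw [map_inf, map_inf, hx, hy, mul_min_of_nonneg _ _ hr.le] }
  have key : ∀ x : vertex p, ψ (x : A123) = r * φ (x : A123) := fun x =>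
    ClosureOperator.closure_min (c := lClosure A123) h hl x.2
  simp only [Hits, key, ne_eq, mul_eq_zero, hr.ne', false_or]

/-- Every element of `A_p` depends continuously on the parameter once the generators do, and a
support is a union of nonvanishing loci. -/
theorem isOpen_hits (φ : ℝ → LHom A123 ℝ) {p : Cube}
    (h : ∀ x ∈ vertexGens p, Continuous fun t => φ t x) (S : Idc (vertex p)) :
    IsOpen {t | Hits (φ t) S} := by
  have hl : IsLSubgroup {x : A123 | Continuous fun t => φ t x} :=
    { zero_mem := by simpa using continuous_const
      add_mem := fun x hx y hy => by
        simp only [Set.mem_ofPred_eq, map_add] at *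
        exact hx.add hy
      neg_mem := fun x hx => by
        simp only [Set.mem_ofPred_eq, map_neg] at *
        exact hx.neg
      sup_mem := fun x hx y hy => by simpa using hx.sup hy
      inf_mem := fun x hx y hy => by simpa using hx.inf hy }
  have key : ∀ x : vertex p, Continuous fun t => φ t (x : A123) := fun x =>
    ClosureOperator.closure_min (c := lClosure A123) h hl x.2
  have : {t | Hits (φ t) S} = ⋃ y ∈ S.1, {t | φ t (y : A123) ≠ 0} := by
    ext t
    simp [Hits]
  rw [this]
  exact isOpen_biUnion fun y _ => (key y).isOpen_preimage _ isOpen_ne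

/-! ### Supports along the segment of slopes from zero to infinity -/

theorem isOpen_hits_edgePoint_left (y : ℝ) {p : Cube} (S : Idc (vertex p)) :
    IsOpen {t | Hits (edgePoint t y) S} := by
  refine isOpen_hits _ ?_ S
  rintro _ (⟨rfl, -⟩ | ⟨rfl, -⟩ | ⟨rfl, -⟩ | ⟨rfl, -⟩)
  exacts [continuous_abs, continuous_abs, continuous_const, continuous_const]

theorem isOpen_hits_edgePoint_right (x : ℝ) {p : Cube} (S : Idc (vertex p)) :
    IsOpen {t | Hits (edgePoint x t) S} := by
  refine isOpen_hits _ ?_ S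
  rintro _ (⟨rfl, -⟩ | ⟨rfl, -⟩ | ⟨rfl, -⟩ | ⟨rfl, -⟩)
  exacts [continuous_const, continuous_const, continuous_abs, continuous_abs]

/-- Openness moves the point of infinite slope to a nearby `(ε / 2, 1)`, which lies on the ray of
`(1, 2 / ε)`. -/
theorem exists_hits_edgePoint_one {p : Cube} {V : Idc (vertex p)} (hV : Hits (edgePoint 0 1) V) :
    ∃ t : ℝ, 0 < t ∧ Hits (edgePoint 1 t) V := by
  obtain ⟨ε, hε, h⟩ := Metric.isOpen_iff.1 (isOpen_hits_edgePoint_left 1 V) 0 hV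
  have hV' : Hits (edgePoint (ε / 2) 1) V :=
    h (by simp [abs_of_pos hε, hε])
  refine ⟨(ε / 2)⁻¹, by positivity, (hits_congr (r := (ε / 2)⁻¹) (by positivity) ?_ V).1 hV'⟩
  have e1 : |(1 : ℝ)| = (ε / 2)⁻¹ * |ε / 2| := by
    rw [abs_one, abs_of_pos (by positivity : 0 < ε / 2)]
    field_simp
  have e2 : |(ε / 2)⁻¹| = (ε / 2)⁻¹ * |(1 : ℝ)| := by
    rw [abs_one, mul_one, abs_of_pos (by positivity)]
  rintro _ (⟨rfl, -⟩ | ⟨rfl, -⟩ | ⟨rfl, -⟩ | ⟨rfl, -⟩)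
  exacts [e1, e1, e2, e2]

/-- If `U` and `V` have disjoint supports, one containing the point of slope zero and the other one
the point of infinite slope, then some positive slope is in neither support. -/
theorem exists_not_hits {p : Cube} {U V : Idc (vertex p)}
    (hUV : ∀ φ, Hits φ U → ¬ Hits φ V) (hU : Hits (edgePoint 1 0) U)
    (hV : Hits (edgePoint 0 1) V) :
    ∃ t : ℝ, 0 < t ∧ ¬ Hits (edgePoint 1 t) U ∧ ¬ Hits (edgePoint 1 t) V := by
  by_contra! h
  obtain ⟨T, -, hT⟩ := exists_hits_edgePoint_one hV
  -- Absolute values in `edgePoint` extend the family of slopes to all of ℝ, so connectedness of ℝ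
  -- itself applies.
  have hcover : Set.univ ⊆ {t | Hits (edgePoint 1 t) U} ∪ {t | Hits (edgePoint 1 t) V} := by
    intro t _
    by_cases ht : t = 0
    · exact Or.inl (ht ▸ hU)
    · have e : edgePoint 1 |t| = edgePoint 1 t := by simp only [edgePoint, abs_abs]
      have := h |t| (abs_pos.2 ht)
      rw [e] at this
      exact or_iff_not_imp_left.2 this
  obtain ⟨t, -, h1, h2⟩ := isPreconnected_univ _ _ (isOpen_hits_edgePoint_right 1 U)
    (isOpen_hits_edgePoint_right 1 V) hcover ⟨0, trivial, hU⟩ ⟨T, trivial, hT⟩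
  exact hUV _ h1 h2

/-- If `U` and `V` have disjoint supports, one containing the point of slope zero and the other one
the point of infinite slope, then the support of `V` is not closed under halving slopes. -/
theorem exists_hits_not_hits_half {p : Cube} {U V : Idc (vertex p)}
    (hUV : ∀ φ, Hits φ U → ¬ Hits φ V) (hU : Hits (edgePoint 1 0) U)
    (hV : Hits (edgePoint 0 1) V) :
    ∃ t : ℝ, 0 < t ∧ Hits (edgePoint 1 t) V ∧ ¬ Hits (edgePoint 1 (t / 2)) V := by
  by_contra! h
  obtain ⟨T, hT0, hT⟩ := exists_hits_edgePoint_one hV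
  -- Repeated halving would keep `V` hit at slopes tending to 0, which eventually enter the open
  -- neighbourhood of 0 where `U` is hit.
  have key : ∀ n : ℕ, Hits (edgePoint 1 (T * (1 / 2) ^ n)) V := by
    intro n
    induction n with
    | zero => simpa using hT
    | succ n ih =>
      have := h _ (by positivity) ih
      rwa [pow_succ, ← mul_assoc, mul_one_div]
  have hlim : Filter.Tendsto (fun n : ℕ => T * (1 / 2 : ℝ) ^ n) Filter.atTop (nhds 0) := by
    simpa using (tendsto_pow_atTop_nhds_zero_of_lt_one (r := (1 / 2 : ℝ)) (by norm_num)
      (by norm_num)).const_mul T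
  obtain ⟨n, hn⟩ := (hlim.eventually ((isOpen_hits_edgePoint_right 1 U).mem_nhds hU)).exists
  exact hUV _ hn (key n)

end A123

/-! ### The contradiction at the top of the cube -/

open A123

/-- There is no commutative diagram `G` of ℓ-groups with a natural family of surjective
maps onto the vertices of `diagA.idc` that behave like `x ↦ ⟨x⟩`. -/
theorem not_exists_commutative_lift (G : LGroupDiagram.{u} Cube) (hG : G.IsCommutative)
    (σ : ∀ p, G.obj p → Idc (vertex p))
    (hle : ∀ p (x y z : G.obj p), 0 ≤ x → x ≤ y + z → σ p x ≤ σ p y ⊔ σ p z)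
    (hdisj : ∀ p (x y : G.obj p) S, x ⊓ y = 0 → S ≤ σ p x → S ≤ σ p y → S = ⊥)
    (hnat : ∀ {p q : Cube} (h : p ≤ q), ∀ f ∈ G.arrows h, ∀ g ∈ diagArrows p q, ∀ x,
      σ q (f x) = Idc.map g (σ p x))
    (hsurj : ∀ p S, ∃ x : G.obj p, 0 ≤ x ∧ σ p x = S) : False := by
  choose F hF using hG
  have hFmem : ∀ {p q : Cube} (h : p ≤ q), F p q h ∈ G.arrows h := fun h => by rw [hF]; rfl
  have hFcomp : ∀ {p q r : Cube} (hpq : p ≤ q) (hqr : q ≤ r) (x : G.obj p),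
      F q r hqr (F p q hpq x) = F p r (hpq.trans hqr) x := fun hpq hqr x => by
    have h := G.comp_mem hpq hqr _ (hFmem hpq) _ (hFmem hqr)
    rw [hF, Set.mem_singleton_iff] at h
    rw [← h, LHom.comp_apply]
  have hF0 : ∀ {p q : Cube} (h : p ≤ q) {x : G.obj p}, 0 ≤ x → 0 ≤ F p q h x := fun h x hx => by
    simpa using OrderHomClass.mono (F _ _ h) hx
  have hgen : ∀ {p q : Cube} (h : p ≤ q) (x : G.obj p) (v : vertex p) (w : A123),
      (∀ g ∈ diagArrows p q, (g v : A123) = w) → σ p x = FGClosed.principal _ v →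
      ∀ φ, Hits φ (σ q (F p q h x)) ↔ φ w ≠ 0 := by
    intro p q h x v w hw hx φ
    obtain ⟨g, hg⟩ := diagArrows_nonempty h
    have e : Idc.map g (FGClosed.principal _ v) = FGClosed.principal _ (g v) :=
      FGClosed.map_principal _ _ v
    rw [hnat h _ (hFmem h) g hg, hx, e, hits_principal, hw g hg]
  -- Away from the vertex 1, the arrow to the top is the inclusion, so passing to the top does not
  -- change which points are hit.
  have hincl : ∀ {p : Cube} (h : p ≤ Finset.univ) (x : G.obj p) (φ : LHom A123 ℝ), p ≠ {0} →
      (Hits φ (σ _ (F p _ h x)) ↔ Hits φ (σ p x)) := by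
    intro p h x φ hp
    obtain ⟨g, hg⟩ := diagArrows_nonempty h
    rw [hnat h _ (hFmem h) g hg, hits_map_iff]
    rcases hg with ⟨-, hg⟩ | ⟨-, hp', -⟩
    · exact hg
    · exact absurd hp' hp
  -- `d x y` is the ideal generated by the positive part of `x - y`.
  let d : ∀ {p : Cube}, G.obj p → G.obj p → Idc (vertex p) := fun x y => σ _ ((x - y) ⊔ 0)
  have hd_disj : ∀ {p : Cube} (x y : G.obj p) (φ : LHom A123 ℝ), Hits φ (d x y) →
      ¬ Hits φ (d y x) := by
    intro p x y φ h1 h2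
    obtain ⟨U, hU1, hU2, hU⟩ := h1.exists_ne_bot h2
    exact hU (hdisj _ _ _ U (sub_sup_zero_inf_sub_sup_zero x y) hU1 hU2)
  -- Any third element `y` must lie below `x` or above `z`; this is subadditivity of positive parts.
  have hd_tri : ∀ {p : Cube} (x y z : G.obj p) (φ : LHom A123 ℝ), Hits φ (d x z) →
      Hits φ (d x y) ∨ Hits φ (d y z) := fun x y z φ h =>
    (h.mono (hle _ _ _ _ le_sup_right (sub_sup_zero_le_add x y z))).of_sup
  have hd_of : ∀ {p : Cube} (x y : G.obj p) (φ : LHom A123 ℝ), 0 ≤ x → Hits φ (σ p x) →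
      ¬ Hits φ (σ p y) → Hits φ (d x y) := fun x y φ hx h hy =>
    (h.mono (hle _ _ _ _ hx (le_sub_sup_zero_add x y))).of_sup.resolve_right hy
  have hd_incl : ∀ {p : Cube} (h : p ≤ Finset.univ) (x y : G.obj p) (φ : LHom A123 ℝ), p ≠ {0} →
      (Hits φ (d (F p _ h x) (F p _ h y)) ↔ Hits φ (d x y)) := by
    intro p h x y φ hp
    rw [← hincl h _ φ hp, LHom.map_sub_sup_zero]
  have hb : b ∈ vertex {1} :=
    subset_vertex _ (Or.inr (Or.inr (Or.inl ⟨rfl, by decide⟩)))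
  have hc : c ∈ vertex {2} :=
    subset_vertex _ (Or.inr (Or.inr (Or.inr ⟨rfl, by decide⟩)))
  obtain ⟨α, hα0, hα⟩ := hsurj {0} (FGClosed.principal _ ⟨a, a_mem_vertex⟩)
  obtain ⟨β, hβ0, hβ⟩ := hsurj {1} (FGClosed.principal _ ⟨b, hb⟩)
  obtain ⟨γ, hγ0, hγ⟩ := hsurj {2} (FGClosed.principal _ ⟨c, hc⟩)
  have l01 : ({0} : Cube) ≤ {0, 1} := by decide
  have l02 : ({0} : Cube) ≤ {0, 2} := by decide
  have l10 : ({1} : Cube) ≤ {0, 1} := by decide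
  have l12 : ({1} : Cube) ≤ {1, 2} := by decide
  have l20 : ({2} : Cube) ≤ {0, 2} := by decide
  have l21 : ({2} : Cube) ≤ {1, 2} := by decide
  have hα01 := hgen l01 α ⟨a, a_mem_vertex⟩ a (by
    rintro g (⟨-, hg⟩ | ⟨h, -⟩)
    · exact hg _
    · exact absurd h (by decide)) hα
  have hα02 := hgen l02 α ⟨a, a_mem_vertex⟩ aPrime (by
    rintro g (⟨h, -⟩ | ⟨-, _, hg⟩)
    · exact absurd ⟨rfl, rfl⟩ h
    · exact hg) hα
  have hβ01 := hgen l10 β ⟨b, hb⟩ b (by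
    rintro g (⟨-, hg⟩ | ⟨-, h, -⟩)
    · exact hg _
    · exact absurd h (by decide)) hβ
  have hγ02 := hgen l20 γ ⟨c, hc⟩ c (by
    rintro g (⟨-, hg⟩ | ⟨-, h, -⟩)
    · exact hg _
    · exact absurd h (by decide)) hγ
  have e0 : |(0 : ℝ)| = 0 := abs_zero
  have e1 : |(1 : ℝ)| ≠ 0 := by simp
  -- At slope `s` in the face 12, `α` and `β` tie.
  obtain ⟨s, hs, hs1, hs2⟩ := exists_not_hits
    (hd_disj (F _ _ l01 α) (F _ _ l10 β))
    (hd_of _ _ _ (hF0 l01 hα0) ((hα01 _).2 e1) fun h => (hβ01 _).1 h e0)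
    (hd_of _ _ _ (hF0 l10 hβ0) ((hβ01 _).2 e1) fun h => (hα01 _).1 h e0)
  -- In the face 13, `γ` exceeds `α` at slope `t` but not at `t / 2`.
  obtain ⟨t, ht, ht1, ht2⟩ := exists_hits_not_hits_half
    (hd_disj (F _ _ l02 α) (F _ _ l20 γ))
    (hd_of _ _ _ (hF0 l02 hα0) ((hα02 _).2 e1) fun h => (hγ02 _).1 h e0)
    (hd_of _ _ _ (hF0 l20 hγ0) ((hγ02 _).2 e1) fun h => (hα02 _).1 h e0)
  -- The points differ only in `aPrime`, taken at the two extremes of `a ≤ aPrime ≤ 2a`; the faces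
  -- 12 and 23 do not see it.
  let φ : LHom A123 ℝ := point 1 1 s t zero_le_one le_rfl (by norm_num) hs.le ht.le
  let ψ : LHom A123 ℝ := point 1 2 s t zero_le_one one_le_two (by norm_num) hs.le ht.le
  have h01 : ∀ {χ : LHom A123 ℝ}, χ a = 1 → χ b = s → ∀ S : Idc (vertex {0, 1}),
      Hits χ S → Hits (edgePoint 1 s) S := fun ha hb S => by
    refine (hits_congr one_pos ?_ S).1
    rintro _ (⟨rfl, -⟩ | ⟨-, h⟩ | ⟨rfl, -⟩ | ⟨-, h⟩)
    · rw [ha, one_mul]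
      exact abs_one
    · exact absurd h (by decide)
    · rw [hb, one_mul]
      exact abs_of_pos hs
    · exact absurd h (by decide)
  have u01 : ({0, 1} : Cube) ≤ Finset.univ := by decide
  have u02 : ({0, 2} : Cube) ≤ Finset.univ := by decide
  have u12 : ({1, 2} : Cube) ≤ Finset.univ := by decide
  have top01 := hd_incl u01 (F _ _ l01 α) (F _ _ l10 β)
  have top10 := hd_incl u01 (F _ _ l10 β) (F _ _ l01 α)
  have top20 := hd_incl u02 (F _ _ l20 γ) (F _ _ l02 α)
  have top21 := hd_incl u12 (F _ _ l21 γ) (F _ _ l12 β)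
  -- Commutativity of `G` enters here: the two routes of each of `α`, `β`, `γ` to the top vertex
  -- give the same element.
  simp only [hFcomp] at top01 top10 top20 top21
  have hφ20 : Hits φ (d (F _ _ l20 γ) (F _ _ l02 α)) := by
    refine (hits_congr one_pos ?_ _).1 ht1
    rintro _ (⟨-, -, h⟩ | ⟨rfl, -⟩ | ⟨-, h⟩ | ⟨rfl, -⟩)
    · exact absurd rfl h
    · rw [one_mul]
      exact abs_one.symm
    · exact absurd h (by decide)
    · rw [one_mul]
      exact (abs_of_pos ht).symm
  -- At `φ`, `γ > α` and the tie of `α` with `β` give `γ > β`.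
  have hφ21 : Hits φ (d (F _ _ l21 γ) (F _ _ l12 β)) := by
    rw [← top21 φ (by decide)]
    refine (hd_tri _ _ _ φ ((top20 φ (by decide)).2 hφ20)).resolve_right fun h => ?_
    exact hs2 (h01 rfl rfl _ ((top10 φ (by decide)).1 h))
  -- The points `φ` and `ψ` agree on `b` and `c`, hence on the whole face 23.
  have hψ21 : Hits ψ (d (F _ _ l21 γ) (F _ _ l12 β)) := by
    refine (hits_congr one_pos ?_ _).1 hφ21
    rintro _ (⟨-, h, -⟩ | ⟨-, h⟩ | ⟨rfl, -⟩ | ⟨rfl, -⟩)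
    · exact absurd h (by decide)
    · exact absurd h (by decide)
    · exact (one_mul _).symm
    · exact (one_mul _).symm
  -- The tie, used in the other direction at `ψ`, returns from `β` to `α`.
  have hψ20 : Hits ψ (d (F _ _ l20 γ) (F _ _ l02 α)) := by
    rw [← top20 ψ (by decide)]
    refine (hd_tri _ _ _ ψ ((top21 ψ (by decide)).2 hψ21)).resolve_right fun h => ?_
    exact hs1 (h01 rfl rfl _ ((top01 ψ (by decide)).1 h))
  -- On the face 13, `ψ` takes the values `(2, t)`, which lie on the ray of `(1, t / 2)`.
  refine ht2 ((hits_congr (r := 1 / 2) (by norm_num) ?_ _).1 hψ20)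
  rintro _ (⟨-, -, h⟩ | ⟨rfl, -⟩ | ⟨-, h⟩ | ⟨rfl, -⟩)
  · exact absurd rfl h
  · change |(1 : ℝ)| = 1 / 2 * 2
    norm_num
  · exact absurd h (by decide)
  · change |t / 2| = 1 / 2 * t
    rw [abs_of_pos (by positivity)]
    ring

/-! ### Deducing both statements from the obstruction -/

/-- An isomorphism from a commutative diagram is natural with respect to all arrows. -/
theorem SemilatDiagram.Iso.natural {P : Type w} [PartialOrder P] {D : SemilatDiagram.{u} P}
    {E : SemilatDiagram.{v} P} (e : D.Iso E) (hD : D.IsCommutative) {p q : P} (h : p ≤ q)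
    {f : SupBotHom (D.obj p) (D.obj q)} (hf : f ∈ D.arrows h)
    {g : SupBotHom (E.obj p) (E.obj q)} (hg : g ∈ E.arrows h) (x : D.obj p) :
    e.equiv q (f x) = g (e.equiv p x) := by
  obtain ⟨f', hf', hfg⟩ := (e.arrows_iff h g).1 hg
  obtain ⟨k, hk⟩ := hD p q h
  rw [hk, Set.mem_singleton_iff] at hf hf'
  rw [hfg, hf, hf']

theorem not_nonempty_csc_iso (G : LGroupDiagram.{u} Cube) (hG : G.IsCommutative) :
    ¬ Nonempty (G.csc.Iso diagA.idc) := by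
  rintro ⟨e⟩
  have hcl : ∀ p (S : Set (G.obj p)), (convexLClosure (G.obj p)).IsClosed S →
      IsConvexLSubgroup S := fun _ _ h => h
  have hcomm : G.csc.IsCommutative := fun p q h => by
    obtain ⟨f, hf⟩ := hG p q h
    exact ⟨Csc.map f, by simp [hf]⟩
  refine not_exists_commutative_lift G hG (fun p x => e.equiv p (FGClosed.principal _ x))
    ?_ ?_ ?_ ?_
  · intro p x y z hx h
    rw [← OrderIso.map_sup]
    exact (e.equiv p).monotone (FGClosed.principal_le_sup (hcl p) hx h)
  · intro p x y S hxy hSx hSy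
    rw [← (e.equiv p).symm_apply_le] at hSx hSy
    rw [← map_eq_bot_iff (e.equiv p).symm, eq_bot_iff]
    intro s hs
    rw [eq_zero_of_mem_convexLClosure hxy (hSx hs) (hSy hs)]
    exact (hcl p _ (FGClosed.isClosed ⊥)).zero_mem
  · intro p q h f hf g hg x
    have := e.natural hcomm h (Set.mem_image_of_mem Csc.map hf) (Set.mem_image_of_mem Idc.map hg)
      (FGClosed.principal _ x)
    rw [← this]
    exact congrArg _ (FGClosed.map_principal _ _ x).symm
  · intro p S
    obtain ⟨x, hx, h⟩ := FGClosed.exists_eq_principal (hcl p) ((e.equiv p).symm S)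
    exact ⟨x, hx, by rw [h, OrderIso.apply_symm_apply]⟩

/-- Compared with convex ℓ-subgroups, the essential change is in the disjointness condition, which
now comes from representability. -/
theorem not_nonempty_idc_iso (G : LGroupDiagram.{u} Cube) (hG : G.IsCommutative)
    (hrep : ∀ p, IsRepresentable (G.obj p)) : ¬ Nonempty (G.idc.Iso diagA.idc) := by
  rintro ⟨e⟩
  have hcl : ∀ p (S : Set (G.obj p)), (lIdealClosure (G.obj p)).IsClosed S →
      IsConvexLSubgroup S := fun _ _ h => IsLIdeal.toIsConvexLSubgroup h
  have hcomm : G.idc.IsCommutative := fun p q h => by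
    obtain ⟨f, hf⟩ := hG p q h
    exact ⟨Idc.map f, by simp [hf]⟩
  refine not_exists_commutative_lift G hG (fun p x => e.equiv p (FGClosed.principal _ x))
    ?_ ?_ ?_ ?_
  · intro p x y z hx h
    rw [← OrderIso.map_sup]
    exact (e.equiv p).monotone (FGClosed.principal_le_sup (hcl p) hx h)
  · intro p x y S hxy hSx hSy
    rw [← (e.equiv p).symm_apply_le] at hSx hSy
    rw [← map_eq_bot_iff (e.equiv p).symm, eq_bot_iff]
    intro s hs
    rw [(hrep p).eq_zero_of_mem_lIdealClosure hxy (hSx hs) (hSy hs)]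
    exact (hcl p _ (FGClosed.isClosed ⊥)).zero_mem
  · intro p q h f hf g hg x
    have := e.natural hcomm h (Set.mem_image_of_mem Idc.map hf) (Set.mem_image_of_mem Idc.map hg)
      (FGClosed.principal _ x)
    rw [← this]
    exact congrArg _ (FGClosed.map_principal _ _ x).symm
  · intro p S
    obtain ⟨x, hx, h⟩ := FGClosed.exists_eq_principal (hcl p) ((e.equiv p).symm S)
    exact ⟨x, hx, by rw [h, OrderIso.apply_symm_apply]⟩

end LatGrp

theorem corollary5p14 :
    (¬ ∃ G : LatGrp.LGroupDiagram.{u} LatGrp.A123.Cube,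
      G.IsCommutative ∧ Nonempty (G.csc.Iso LatGrp.diagA.idc)) ∧
    (¬ ∃ G : LatGrp.LGroupDiagram.{u} LatGrp.A123.Cube,
      G.IsCommutative ∧ (∀ p, LatGrp.IsRepresentable (G.obj p)) ∧
        Nonempty (G.idc.Iso LatGrp.diagA.idc)) := by
  exact ⟨fun ⟨G, hG, h⟩ => LatGrp.not_nonempty_csc_iso G hG h,
    fun ⟨G, hG, hrep, h⟩ => LatGrp.not_nonempty_idc_iso G hG hrep h⟩
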